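/- Let $R$ be a commutative integral domain in which $2$ is invertible, let $n \ge 2$, and let $T_n(R)$ be the $R$-algebra of all upper triangular $n \times n$ matrices over $R$. Write $[x,y] = xy - yx$. Let $\mathfrak{l} : T_n(R) \to T_n(R)$ be a Lie triple isomorphism, that is, an $R$-linear bijection such that $\mathfrak{l}([[x,y],z]) = [[\mathfrak{l}(x),\mathfrak{l}(y)],\mathfrak{l}(z)]$ for all $x,y,z \in T_n(R)$. Then there exist an $R$-linear bijection $\mathfrak{m} : T_n(R) \to T_n(R)$, which is either an automorphism ($\mathfrak{m}(xy) = \mathfrak{m}(x)\mathfrak{m}(y)$ for all $x, y$) or an anti-automorphism ($\mathfrak{m}(xy) = \mathfrak{m}(y)\mathfrak{m}(x)$ for all $x, y$) of the algebra $T_n(R)$, and an $R$-linear map $\mathfrak{n} : T_n(R) \to R \cdot 1$ with $\mathfrak{n}([[x,y],z]) = 0$ for all $x,y,z \in T_n(R)$, such that $\mathfrak{l} = \mathfrak{m} + \mathfrak{n}$ or $\mathfrak{l} = -\mathfrak{m} + \mathfrak{n}$. -/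

import Mathlib

/-- The algebra `T_n(R)` of upper triangular `n × n` matrices over `R`, as an `R`-subalgebra of the
full matrix algebra: the matrices `M` with `M i j = 0` whenever `j < i`. -/
abbrev upperTriangular (R : Type*) [CommRing R] (n : ℕ) :
    Subalgebra R (Matrix (Fin n) (Fin n) R) :=
  Matrix.blockTriangularSubalgebra R R (id : Fin n → Fin n)

/-- An `R`-linear bijection `l : A → B` of associative `R`-algebras is a Lie triple isomorphism if
`l [[a, b], c] = [[l a, l b], l c]`, where `[x, y] = x * y - y * x`. -/
def IsLieTripleIso {R A B : Type*} [CommRing R] [Ring A] [Algebra R A] [Ring B] [Algebra R B]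
    (l : A ≃ₗ[R] B) : Prop :=
  ∀ a b c : A, l ⁅⁅a, b⁆, c⁆ = ⁅⁅l a, l b⁆, l c⁆

/-- An `R`-linear bijection is an isomorphism of algebras if it is multiplicative
(it then maps `1` to `1`). -/
def IsAlgIso {R A B : Type*} [CommRing R] [Ring A] [Algebra R A] [Ring B] [Algebra R B]
    (m : A ≃ₗ[R] B) : Prop :=
  ∀ a b : A, m (a * b) = m a * m b

/-- An `R`-linear bijection is an anti-isomorphism of algebras if it reverses products
(it then maps `1` to `1`). -/
def IsAlgAntiIso {R A B : Type*} [CommRing R] [Ring A] [Algebra R A] [Ring B] [Algebra R B]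
    (m : A ≃ₗ[R] B) : Prop :=
  ∀ a b : A, m (a * b) = m b * m a

/-! A Lie triple isomorphism `l` respects the strictly upper triangular matrices and those that also
vanish on the superdiagonal, because the relevant matrix units are triple brackets. On the quotient,
the double action of `x`, `y` on the `i`-th superdiagonal line is the product of the simple roots
`α_i(x) α_i(y)`. Over a domain, comparing these products shows that `l` carries each simple root to
another one up to sign (`exists_simpleRoot_map`). Entries two steps above the diagonal show that
neighbouring roots go to neighbouring roots with equal signs, so the permutation is the identity or
the reversal, with one global sign (`simpleRoot_map_eq`). Negation removes the sign and the
antitranspose removes the reversal. What remains fixes all differences of diagonal entries.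
Subtracting a scalar-valued map makes it fix the diagonal itself (`exists_algIso_add_central`). Then
the images of the `E_ii` are orthogonal idempotents and an eigenvalue argument forces
multiplicativity (`isAlgIso_of_diag`). -/

namespace UpperTriangular

/-! ### Commutator identities -/

section Commutator

variable {A : Type*} [Ring A] (a b c : A)

lemma ring_lie_skew : -⁅b, a⁆ = ⁅a, b⁆ := by
  simp [Ring.lie_def]

lemma ring_add_lie : ⁅a + b, c⁆ = ⁅a, c⁆ + ⁅b, c⁆ := by
  simp only [Ring.lie_def, add_mul, mul_add]; abel

lemma ring_lie_add : ⁅a, b + c⁆ = ⁅a, b⁆ + ⁅a, c⁆ := by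
  simp only [Ring.lie_def, add_mul, mul_add]; abel

lemma ring_lie_sub : ⁅a, b - c⁆ = ⁅a, b⁆ - ⁅a, c⁆ := by
  simp only [Ring.lie_def, sub_mul, mul_sub]; abel

lemma ring_zero_lie : ⁅(0 : A), a⁆ = 0 := by
  simp [Ring.lie_def]

lemma ring_neg_lie : ⁅-a, b⁆ = -⁅a, b⁆ := by
  simp only [Ring.lie_def, neg_mul, mul_neg, neg_sub, sub_neg_eq_add]; abel

lemma ring_lie_neg : ⁅a, -b⁆ = -⁅a, b⁆ := by
  simp only [Ring.lie_def, neg_mul, mul_neg, neg_sub, sub_neg_eq_add]; abel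

lemma ring_lie_lie_comm : ⁅c, ⁅b, a⁆⁆ = ⁅⁅a, b⁆, c⁆ := by
  simp only [Ring.lie_def, mul_sub, sub_mul, mul_assoc]; abel

end Commutator

/-! ### Matrix units, diagonals and the centre -/

variable {R : Type*} [CommRing R] {n s : ℕ}

lemma apply_eq_zero (x : upperTriangular R n) {a b : Fin n} (h : b < a) : x.1 a b = 0 :=
  x.2 h

lemma ext_le {x y : upperTriangular R n} (h : ∀ a b, a ≤ b → x.1 a b = y.1 a b) : x = y := by
  apply Subtype.ext
  ext a b
  rcases le_or_gt a b with hab | hab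
  · exact h a b hab
  · rw [apply_eq_zero x hab, apply_eq_zero y hab]

/-- The matrix unit at `(a, b)`, for `a ≤ b` (and `0` otherwise). -/
def unit (R : Type*) [CommRing R] {n : ℕ} (a b : Fin n) : upperTriangular R n :=
  ⟨fun i j => if a ≤ b ∧ a = i ∧ b = j then 1 else 0, by
    intro i j hij
    refine if_neg ?_
    rintro ⟨h, rfl, rfl⟩
    exact absurd h (not_le.2 hij)⟩

lemma unit_apply (a b i j : Fin n) :
    (unit R a b).1 i j = if a ≤ b ∧ a = i ∧ b = j then 1 else 0 := rfl

lemma coe_unit {a b : Fin n} (h : a ≤ b) : (unit R a b).1 = Matrix.single a b 1 := by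
  ext i j
  simp [unit_apply, h, Matrix.single_apply]

lemma unit_mul_unit {a b c d : Fin n} (hab : a ≤ b) (hcd : c ≤ d) :
    unit R a b * unit R c d = if b = c then unit R a d else 0 := by
  apply Subtype.ext
  rw [MulMemClass.coe_mul, coe_unit hab, coe_unit hcd]
  split_ifs with h
  · subst h
    rw [coe_unit (hab.trans hcd), Matrix.single_mul_single_same, one_mul]
  · rw [Matrix.single_mul_single_of_ne _ _ _ _ h]
    rfl

lemma eq_sum_unit (x : upperTriangular R n) : x = ∑ a, ∑ b, x.1 a b • unit R a b := by
  apply ext_le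
  intro i j hij
  have : ∀ f : Fin n → Fin n → upperTriangular R n,
      (∑ a, ∑ b, f a b).1 i j = ∑ a, ∑ b, (f a b).1 i j := by
    intro f
    simp [AddSubmonoidClass.coe_finsetSum, Matrix.sum_apply]
  rw [this, Finset.sum_eq_single i, Finset.sum_eq_single j]
  · simp [unit_apply, hij]
  · intro b _ hb
    simp [unit_apply, hb]
  · simp
  · intro a _ ha
    simp [unit_apply, ha]
  · simp

lemma mul_apply_diag (x y : upperTriangular R n) (a : Fin n) :
    (x * y).1 a a = x.1 a a * y.1 a a := by
  rw [MulMemClass.coe_mul, Matrix.mul_apply, Finset.sum_eq_single a]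
  · intro c _ hc
    rcases lt_or_gt_of_ne hc with h | h
    · rw [apply_eq_zero x h, zero_mul]
    · rw [apply_eq_zero y h, mul_zero]
  · simp

lemma lie_apply_diag (x y : upperTriangular R n) (a : Fin n) : (⁅x, y⁆).1 a a = 0 := by
  rw [Ring.lie_def, AddSubgroupClass.coe_sub, Matrix.sub_apply, mul_apply_diag, mul_apply_diag,
    mul_comm, sub_self]

/-- The entry at `(a, b)` of a commutator with a matrix that vanishes on the entries
strictly between `(a, b)` and the diagonal. -/
lemma lie_apply_of_vanish (w x : upperTriangular R n) (a b : Fin n)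
    (hw : ∀ c d, a ≤ c → d ≤ b → (c ≠ a ∨ d ≠ b) → w.1 c d = 0) :
    (⁅w, x⁆).1 a b = w.1 a b * (x.1 b b - x.1 a a) := by
  rw [Ring.lie_def, AddSubgroupClass.coe_sub, Matrix.sub_apply, MulMemClass.coe_mul,
    MulMemClass.coe_mul, Matrix.mul_apply, Matrix.mul_apply, Finset.sum_eq_single b,
    Finset.sum_eq_single a]
  · ring
  · intro c _ hc
    rcases lt_or_gt_of_ne hc with h | h
    · rw [apply_eq_zero x h, zero_mul]
    · rw [hw c b h.le le_rfl (Or.inl hc), mul_zero]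
  · simp
  · intro c _ hc
    rcases lt_or_gt_of_ne hc with h | h
    · rw [hw a c le_rfl h.le (Or.inr hc), zero_mul]
    · rw [apply_eq_zero x h, mul_zero]
  · simp

/-- Induction on the distance from the diagonal: once the entries nearer to it vanish, `ad A`
multiplies the `(a, b)` entry by `A_aa - A_bb`, so an eigenvalue `r` different from this kills the
entry. -/
lemma eq_zero_of_eigen [IsDomain R] (q : upperTriangular R n)
    (h : ∀ a b, a ≤ b → q.1 a b = 0 ∨
      ∃ (A : upperTriangular R n) (r : R), ⁅A, q⁆ = r • q ∧ A.1 a a - A.1 b b ≠ r) : q = 0 := by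
  have key : ∀ (k : ℕ) (a b : Fin n), (b : ℕ) - a < k → q.1 a b = 0 := by
    intro k
    induction k with
    | zero => intro a b h; omega
    | succ k ih =>
      intro a b hk
      rcases le_or_gt a b with hab | hab
      · rcases h a b hab with h0 | ⟨A, r, hA, hne⟩
        · exact h0
        · have h1 := lie_apply_of_vanish q A a b (by
            intro c d hc hd hcd
            rcases le_or_gt c d with h | h
            · apply ih
              have := Fin.le_def.1 hc
              have := Fin.le_def.1 hd
              have := Fin.le_def.1 h
              rcases hcd with h' | h'
              · have := Fin.val_ne_of_ne h'
                omega
              · have := Fin.val_ne_of_ne h'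
                omega
            · exact apply_eq_zero q h)
          rw [← ring_lie_skew q A, hA] at h1
          have h2 : -(r * q.1 a b) = q.1 a b * (A.1 b b - A.1 a a) := h1
          have h3 : (A.1 a a - A.1 b b - r) * q.1 a b = 0 := by
            linear_combination h2
          exact (mul_eq_zero.1 h3).resolve_left (sub_ne_zero.2 hne)
      · exact apply_eq_zero q hab
  exact ext_le fun a b _ => key _ a b (Nat.lt_succ_self _)

lemma lie_eq_zero_of_central {x y : upperTriangular R n}
    (h : ∀ z : upperTriangular R n, ⁅⁅x, y⁆, z⁆ = 0) : ⁅x, y⁆ = 0 := by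
  apply ext_le
  intro a b hab
  rcases hab.eq_or_lt with rfl | hlt
  · rw [lie_apply_diag]; rfl
  · have h1 := congrArg (fun z : upperTriangular R n => z.1 a b) (h (unit R b b))
    simp only [Ring.lie_def (_ : upperTriangular R n) (unit R b b), AddSubgroupClass.coe_sub,
      Matrix.sub_apply, MulMemClass.coe_mul, coe_unit (le_refl b), Matrix.mul_single_apply_same,
      Matrix.single_mul_apply_of_ne _ _ _ _ _ hlt.ne] at h1
    simpa using h1

/-- The centre is described by triple brackets alone, so Lie triple isomorphisms preserve it. -/
lemma eq_smul_one_of_central {x : upperTriangular R n}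
    (h : ∀ y z : upperTriangular R n, ⁅⁅x, y⁆, z⁆ = 0) (a : Fin n) :
    x = x.1 a a • 1 := by
  have h0 : ∀ y, x * y = y * x := fun y => sub_eq_zero.1 (lie_eq_zero_of_central (h y))
  have h1 : ∀ b c, b < c → x.1 b c = 0 := by
    intro b c hbc
    have h1 := congrArg (fun z : upperTriangular R n => z.1 b c) (h0 (unit R c c))
    simpa [coe_unit, Matrix.single_mul_apply_of_ne _ _ _ _ _ hbc.ne] using h1
  have h2 : ∀ b c, b ≤ c → x.1 b b = x.1 c c := by
    intro b c hbc
    have h1 := congrArg (fun z : upperTriangular R n => z.1 b c) (h0 (unit R b c))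
    simpa [coe_unit, hbc] using h1
  apply ext_le
  intro b c hbc
  change _ = x.1 a a * (1 : Matrix (Fin n) (Fin n) R) b c
  rcases hbc.eq_or_lt with rfl | hlt
  · rw [Matrix.one_apply_eq, mul_one]
    rcases le_total a b with h | h
    · exact (h2 _ _ h).symm
    · exact h2 _ _ h
  · rw [h1 _ _ hlt, Matrix.one_apply_ne hlt.ne, mul_zero]

/-! ### Reduction to maps that fix the diagonal -/

section DiagonalPreserving

variable [IsDomain R]

omit [IsDomain R] in
lemma map_lie_eq_zero (m : upperTriangular R n ≃ₗ[R] upperTriangular R n) (hm : IsLieTripleIso m)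
    {x y : upperTriangular R n} (h : ⁅x, y⁆ = 0) : ⁅m x, m y⁆ = 0 := by
  apply lie_eq_zero_of_central
  intro z
  obtain ⟨z, rfl⟩ := m.surjective z
  rw [← hm, h, ring_zero_lie, map_zero]

omit [IsDomain R] in
lemma unit_diag_apply_diag (i a : Fin n) : (unit R i i).1 a a = if i = a then 1 else 0 := by
  simp [unit_apply]

/-- A Lie triple automorphism that preserves diagonals is an automorphism. -/
theorem isAlgIso_of_diag (h2 : (2 : R) ≠ 0)
    (m : upperTriangular R n ≃ₗ[R] upperTriangular R n) (hm : IsLieTripleIso m)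
    (hd : ∀ x a, (m x).1 a a = x.1 a a) : IsAlgIso m := by
  have hA : ∀ i a, (m (unit R i i)).1 a a = if i = a then 1 else 0 := fun i a => by
    rw [hd, unit_diag_apply_diag]
  have hcomm : ∀ i j, ⁅m (unit R i i), m (unit R j j)⁆ = 0 := by
    intro i j
    apply map_lie_eq_zero m hm
    rw [Ring.lie_def, unit_mul_unit le_rfl le_rfl, unit_mul_unit le_rfl le_rfl]
    by_cases h : i = j
    · simp [h]
    · simp [h, Ne.symm h]
  have horth : ∀ i j, m (unit R i i) * m (unit R j j) = if i = j then m (unit R i i) else 0 := by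
    intro i j
    rw [← sub_eq_zero]
    apply eq_zero_of_eigen
    intro a b hab
    rcases hab.eq_or_lt with rfl | hlt
    · left
      rw [AddSubgroupClass.coe_sub, Matrix.sub_apply, mul_apply_diag, hA, hA]
      split_ifs <;> simp_all
    · right
      -- The difference commutes with every `m E_aa`, whereas off the diagonal the expected
      -- eigenvalue at `(a, b)` is `1`.
      refine ⟨m (unit R a a), 0, ?_, ?_⟩
      · have hi := sub_eq_zero.1 (hcomm a i)
        have hj := sub_eq_zero.1 (hcomm a j)
        rw [zero_smul, Ring.lie_def, sub_eq_zero, mul_sub, sub_mul, ← mul_assoc, hi, mul_assoc, hj,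
          ← mul_assoc]
        split_ifs
        · rw [hi]
        · simp
      · rw [hA, hA]
        simp [hlt.ne]
  have hsplit : ∀ i j, i < j → ⁅m (unit R i i), m (unit R i j)⁆ = m (unit R i j) ∧
      ⁅m (unit R j j), m (unit R i j)⁆ = - m (unit R i j) := by
    intro i j hij
    have t0 : ⁅unit R i j, unit R i i⁆ = - unit R i j := by
      simp [Ring.lie_def, unit_mul_unit, hij.le, hij.ne']
    have t1 : ⁅⁅unit R i j, unit R i i⁆, unit R i i⁆ = unit R i j := by
      rw [t0, ring_neg_lie, t0, neg_neg]
    have t2 : ⁅⁅unit R i j, unit R i i⁆, unit R j j⁆ = - unit R i j := by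
      rw [t0, ring_neg_lie]
      simp [Ring.lie_def, unit_mul_unit, hij.le, hij.ne']
    have t3 : ⁅unit R i i + unit R j j, unit R i j⁆ = 0 := by
      simp [Ring.lie_def, unit_mul_unit, hij.le, hij.ne', mul_add, add_mul]
    have s1 := hm (unit R i j) (unit R i i) (unit R i i)
    have s2 := hm (unit R i j) (unit R i i) (unit R j j)
    have s3 := map_lie_eq_zero m hm t3
    rw [t1] at s1
    rw [t2, map_neg] at s2
    rw [map_add, ring_add_lie] at s3
    have Ai := hA i
    have Aj := hA j
    revert s1 s2 s3 Ai Aj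
    generalize m (unit R i i) = A
    generalize m (unit R j j) = B
    generalize m (unit R i j) = f
    intro s1 s2 s3 Ai Aj
    have r1 : ⁅A, ⁅A, f⁆⁆ = f := by
      rw [ring_lie_lie_comm, ← s1]
    have r2 : ⁅B, ⁅A, f⁆⁆ = -f := by
      rw [ring_lie_lie_comm, ← s2]
    have hB : ⁅B, f⁆ = -⁅A, f⁆ := by
      rw [eq_neg_iff_add_eq_zero, add_comm]; exact s3
    -- This element has eigenvalue `-1` under `ad A` and `1` under `ad B`. For `b ≠ i` the diagonal
    -- difference of `A` is `0` or `1`, never `-1` since `2 ≠ 0`; for `b = i` both diagonal entries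
    -- of `B` vanish because `a ≤ i < j`.
    have q0 : f - ⁅A, f⁆ = 0 := by
      apply eq_zero_of_eigen
      intro a b hab
      right
      by_cases hb : i = b
      · refine ⟨B, 1, ?_, ?_⟩
        · rw [ring_lie_sub, r2, hB, one_smul]
          abel
        · rw [Aj, Aj, if_neg (by rintro rfl; exact absurd hab (not_le.2 (hb ▸ hij))),
            if_neg (by rintro rfl; exact hij.ne hb)]
          simp
      · refine ⟨A, -1, ?_, ?_⟩
        · rw [ring_lie_sub, r1, neg_smul, one_smul, neg_sub]
        · rw [Ai, Ai, if_neg hb, sub_zero, Ne, eq_neg_iff_add_eq_zero]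
          split_ifs
          · rwa [one_add_one_eq_two]
          · simp
    have q1 := (sub_eq_zero.1 q0).symm
    exact ⟨q1, by rw [hB, q1]⟩
  have two_cancel : ∀ x : upperTriangular R n, x = -x → x = 0 := by
    intro x hx
    apply ext_le
    intro a b _
    have h : x.1 a b = - x.1 a b := congrArg (fun z : upperTriangular R n => z.1 a b) hx
    have : 2 * x.1 a b = 0 := by linear_combination h
    simpa [h2] using this
  have hl : ∀ i j, i ≤ j → m (unit R i i) * m (unit R i j) = m (unit R i j) := by
    intro i j hij
    rcases hij.eq_or_lt with rfl | hlt
    · simp [horth]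
    · have h := (hsplit i j hlt).1
      rw [Ring.lie_def] at h
      have hi : m (unit R i i) * m (unit R i i) = m (unit R i i) := by simp [horth]
      -- For an idempotent `e`, multiplying `ef - fe = f` on the left by `e` gives `efe = 0`; on the
      -- right it then gives `fe = -fe`.
      have h3 : m (unit R i i) * m (unit R i j) * m (unit R i i) = 0 := by
        have := congrArg (m (unit R i i) * ·) h
        simp only [mul_sub, ← mul_assoc, hi] at this
        simpa using this
      have h4 : m (unit R i j) * m (unit R i i) = 0 := by
        have := congrArg (· * m (unit R i i)) h
        simp only [sub_mul, h3, zero_sub, mul_assoc, hi] at this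
        exact two_cancel _ this.symm
      rwa [h4, sub_zero] at h
  have hr : ∀ i j, i ≤ j → m (unit R i j) * m (unit R j j) = m (unit R i j) := by
    intro i j hij
    rcases hij.eq_or_lt with rfl | hlt
    · simp [horth]
    · have h := (hsplit i j hlt).2
      rw [Ring.lie_def, ← neg_inj, neg_sub, neg_neg] at h
      have hi : m (unit R j j) * m (unit R j j) = m (unit R j j) := by simp [horth]
      have h3 : m (unit R j j) * (m (unit R i j) * m (unit R j j)) = 0 := by
        have := congrArg (· * m (unit R j j)) h
        simp only [sub_mul, mul_assoc, hi] at this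
        simpa using this
      have h4 : m (unit R j j) * m (unit R i j) = 0 := by
        have := congrArg (m (unit R j j) * ·) h
        simp only [mul_sub, h3, zero_sub, ← mul_assoc, hi] at this
        exact two_cancel _ this.symm
      rwa [h4, sub_zero] at h
  have hzero : ∀ i j k k', i ≤ j → k ≤ k' → j ≠ k → m (unit R i j) * m (unit R k k') = 0 := by
    intro i j k k' hij hk hne
    rw [← hr i j hij, ← hl k k' hk, mul_assoc, ← mul_assoc (m (unit R j j)), horth, if_neg hne]
    simp
  have hunit : ∀ i j k k', i ≤ j → k ≤ k' →
      m (unit R i j * unit R k k') = m (unit R i j) * m (unit R k k') := by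
    intro i j k k' hij hk
    rw [unit_mul_unit hij hk]
    split_ifs with hjk
    · subst hjk
      rcases hij.eq_or_lt with rfl | hij'
      · rw [hl _ _ hk]
      rcases hk.eq_or_lt with rfl | hk'
      · rw [hr _ _ hij]
      have hik := hij'.trans hk'
      have t : ⁅⁅unit R i j, unit R j k'⁆, unit R k' k'⁆ = unit R i k' := by
        simp [Ring.lie_def, unit_mul_unit, hij, hk, hik.le, hik.ne']
      have s := hm (unit R i j) (unit R j k') (unit R k' k')
      rw [t, Ring.lie_def (m (unit R i j)), hzero j k' i j hk hij hik.ne', sub_zero, Ring.lie_def,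
        mul_assoc, hr _ _ hk, ← mul_assoc, hzero k' k' i j le_rfl hij hik.ne', zero_mul,
        sub_zero] at s
      exact s
    · rw [map_zero, hzero i j k k' hij hk hjk]
  have hunit' : ∀ i j k k',
      m (unit R i j * unit R k k') = m (unit R i j) * m (unit R k k') := by
    intro i j k k'
    have h0 : ∀ a b : Fin n, ¬ a ≤ b → unit R a b = 0 := fun a b h =>
      Subtype.ext (by ext; simp [unit_apply, h])
    by_cases hij : i ≤ j
    · by_cases hk : k ≤ k'
      · exact hunit i j k k' hij hk
      · simp [h0 _ _ hk]
    · simp [h0 _ _ hij]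
  intro x y
  rw [eq_sum_unit x, eq_sum_unit y]
  simp only [Finset.sum_mul, Finset.mul_sum, map_sum, smul_mul_assoc, mul_smul_comm, map_smul,
    hunit']

end DiagonalPreserving

/-- A Lie triple automorphism that preserves differences of diagonal entries is the sum of an
automorphism and a central map. -/
theorem exists_algIso_add_central [IsDomain R] (h2 : (2 : R) ≠ 0)
    (l : upperTriangular R (n + 1) ≃ₗ[R] upperTriangular R (n + 1)) (hl : IsLieTripleIso l)
    (hd : ∀ x a, (l x).1 a a - (l x).1 0 0 = x.1 a a - x.1 0 0) :
    ∃ (m : upperTriangular R (n + 1) ≃ₗ[R] upperTriangular R (n + 1))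
      (ν : upperTriangular R (n + 1) →ₗ[R] upperTriangular R (n + 1)),
      IsAlgIso m ∧ (∀ x, ν x ∈ Submodule.span R {(1 : upperTriangular R (n + 1))}) ∧
      (∀ x y z : upperTriangular R (n + 1), ν ⁅⁅x, y⁆, z⁆ = 0) ∧ ∀ x, l x = m x + ν x := by
  let T := upperTriangular R (n + 1)
  -- By `hd` the shift is the same at every diagonal place, so reading it at `0` suffices.
  let c : T →ₗ[R] R :=
    { toFun := fun x => (l x).1 0 0 - x.1 0 0
      map_add' := fun x y => by simp; ring
      map_smul' := fun r x => by simp; ring }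
  have hc : ∀ x, c x = (l x).1 0 0 - x.1 0 0 := fun _ => rfl
  let ν : T →ₗ[R] T := c.smulRight 1
  have hν : ∀ x, ν x = c x • 1 := fun _ => rfl
  have hνt : ∀ x y z : T, ν ⁅⁅x, y⁆, z⁆ = 0 := by
    intro x y z
    rw [hν, hc, hl, lie_apply_diag, lie_apply_diag, sub_zero, zero_smul]
  let m₀ : T →ₗ[R] T := l.toLinearMap - ν
  have hm₀ : ∀ x, m₀ x = l x - c x • 1 := fun _ => rfl
  have hlm : ∀ x, l x = m₀ x + c x • 1 := fun x => by rw [hm₀, sub_add_cancel]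
  have hdiag : ∀ x a, (m₀ x).1 a a = x.1 a a := by
    intro x a
    have h : (m₀ x).1 a a =
        (l x).1 a a - c x * (1 : Matrix (Fin (n + 1)) (Fin (n + 1)) R) a a := rfl
    rw [h, hc, Matrix.one_apply_eq]
    linear_combination hd x a
  have hsc : ∀ (r : R) (x : T), ⁅r • (1 : T), x⁆ = 0 := fun r x => by
    simp [Ring.lie_def]
  have hsc' : ∀ (r : R) (x : T), ⁅x, r • (1 : T)⁆ = 0 := fun r x => by
    simp [Ring.lie_def]
  have htriple : ∀ x y z : T, m₀ ⁅⁅x, y⁆, z⁆ = ⁅⁅m₀ x, m₀ y⁆, m₀ z⁆ := by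
    intro x y z
    have h1 : m₀ ⁅⁅x, y⁆, z⁆ = l ⁅⁅x, y⁆, z⁆ - ν ⁅⁅x, y⁆, z⁆ := rfl
    rw [h1, hνt, sub_zero, hl, hlm x, hlm y, hlm z]
    simp only [ring_add_lie, ring_lie_add, hsc, hsc', add_zero]
  have hinj : Function.Injective m₀ := by
    rw [injective_iff_map_eq_zero]
    intro x hx
    have h := eq_smul_one_of_central (x := x) (by
      intro y z
      apply l.injective
      rw [hl, hlm x, hx, zero_add, hsc, ring_zero_lie, map_zero]) 0
    rw [h, ← hdiag, hx]
    exact zero_smul _ _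
  have hone : m₀ 1 = 1 := by
    have h := eq_smul_one_of_central (x := m₀ 1) (by
      intro y z
      obtain ⟨y, rfl⟩ := l.surjective y
      obtain ⟨z, rfl⟩ := l.surjective z
      rw [hlm y, hlm z]
      simp only [ring_lie_add, hsc', add_zero]
      rw [← htriple, ← one_smul R (1 : T), hsc, ring_zero_lie, map_zero]) 0
    rw [h, hdiag]
    change (1 : Matrix (Fin (n + 1)) (Fin (n + 1)) R) 0 0 • _ = _
    rw [Matrix.one_apply_eq, one_smul]
  have hsurj : Function.Surjective m₀ := by
    intro y
    -- Since `m₀ 1 = 1`, the scalar subtracted from `l` can be added back.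
    refine ⟨l.symm y + c (l.symm y) • 1, ?_⟩
    rw [map_add, map_smul, hone, ← hlm, LinearEquiv.apply_symm_apply]
  let m := LinearEquiv.ofBijective m₀ ⟨hinj, hsurj⟩
  refine ⟨m, ν, isAlgIso_of_diag h2 m htriple hdiag, ?_, hνt, fun x => hlm x⟩
  intro x
  exact Submodule.smul_mem _ _ (Submodule.mem_span_singleton_self _)

/-! ### Simple roots, coweights and superdiagonal entries -/

/-- The `j`-th simple root: the difference of two consecutive diagonal entries. -/
def simpleRoot (j : Fin s) (x : upperTriangular R (s + 1)) : R :=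
  x.1 j.castSucc j.castSucc - x.1 j.succ j.succ

/-- The fundamental coweight dual to the `i`-th simple root. -/
def coweight (R : Type*) [CommRing R] {s : ℕ} (i : Fin s) : upperTriangular R (s + 1) :=
  ⟨Matrix.diagonal fun a => if a ≤ i.castSucc then 1 else 0,
    fun _ _ h => Matrix.diagonal_apply_ne' _ (ne_of_lt h)⟩

/-- The matrix unit spanning the `i`-th simple root space. -/
def simpleUnit (R : Type*) [CommRing R] {s : ℕ} (i : Fin s) : upperTriangular R (s + 1) :=
  unit R i.castSucc i.succ

lemma simpleRoot_coweight (i j : Fin s) :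
    simpleRoot j (coweight R i) = if i = j then 1 else 0 := by
  simp only [simpleRoot, coweight, Matrix.diagonal_apply_eq, Fin.le_def, Fin.val_castSucc,
    Fin.val_succ, Fin.ext_iff]
  split_ifs <;> first | omega | simp

lemma simpleRoot_sub (j : Fin s) (x y : upperTriangular R (s + 1)) :
    simpleRoot j (x - y) = simpleRoot j x - simpleRoot j y := by
  simp only [simpleRoot, AddSubgroupClass.coe_sub, Matrix.sub_apply]
  ring

lemma simpleUnit_apply_diag (i : Fin s) (a : Fin (s + 1)) : (simpleUnit R i).1 a a = 0 := by
  rw [simpleUnit, unit_apply, if_neg]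
  rintro ⟨-, rfl, h⟩
  exact (Fin.castSucc_lt_succ (i := i)).ne' h

lemma simpleUnit_apply (i j : Fin s) :
    (simpleUnit R i).1 j.castSucc j.succ = if i = j then 1 else 0 := by
  rw [simpleUnit, unit_apply]
  simp [Fin.castSucc_lt_succ.le]

lemma lie_simpleUnit_coweight (i k : Fin s) :
    ⁅simpleUnit R i, coweight R k⁆ = (-simpleRoot i (coweight R k)) • simpleUnit R i := by
  apply ext_le
  intro a b _
  rw [Ring.lie_def, AddSubgroupClass.coe_sub, Matrix.sub_apply, MulMemClass.coe_mul,
    MulMemClass.coe_mul]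
  change _ = -simpleRoot i (coweight R k) * (simpleUnit R i).1 a b
  rw [simpleRoot]
  simp only [coweight, Matrix.mul_diagonal, Matrix.diagonal_mul, Matrix.diagonal_apply_eq,
    simpleUnit, unit_apply]
  by_cases h : i.castSucc ≤ i.succ ∧ i.castSucc = a ∧ i.succ = b
  · obtain ⟨-, rfl, rfl⟩ := h
    ring
  · simp [h]

/-- The bracket has weight `α_i + α_j`, which vanishes on the difference of the two dual coweights.
-/
lemma lie_lie_simpleUnit_coweight (i j : Fin s) :
    ⁅⁅simpleUnit R i, simpleUnit R j⁆, coweight R i - coweight R j⁆ = 0 := by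
  have key : ∀ (e f h : upperTriangular R (s + 1)) (a b : R), ⁅e, h⁆ = a • e → ⁅f, h⁆ = b • f →
      ⁅⁅e, f⁆, h⁆ = (a + b) • ⁅e, f⁆ := by
    intro e f h a b he hf
    have : ⁅⁅e, f⁆, h⁆ = ⁅⁅e, h⁆, f⁆ + ⁅e, ⁅f, h⁆⁆ := by
      simp only [Ring.lie_def, mul_sub, sub_mul, mul_assoc]; abel
    rw [this, he, hf]
    simp only [Ring.lie_def, add_smul, smul_sub, smul_mul_assoc, mul_smul_comm]
    abel
  rw [ring_lie_sub, key _ _ _ _ _ (lie_simpleUnit_coweight i i) (lie_simpleUnit_coweight j i),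
    key _ _ _ _ _ (lie_simpleUnit_coweight i j) (lie_simpleUnit_coweight j j), ← sub_smul]
  simp only [simpleRoot_coweight]
  by_cases h : i = j
  · simp [h]
  · simp [h, Ne.symm h]

lemma lie_simpleUnit_eq_zero {i j : Fin s} (h1 : (i : ℕ) + 1 ≠ j) (h2 : (j : ℕ) + 1 ≠ i) :
    ⁅simpleUnit R i, simpleUnit R j⁆ = 0 := by
  have h1' : i.succ ≠ j.castSucc := fun h => h1 (by simpa using congrArg Fin.val h)
  have h2' : j.succ ≠ i.castSucc := fun h => h2 (by simpa using congrArg Fin.val h)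
  rw [Ring.lie_def, simpleUnit, simpleUnit, unit_mul_unit Fin.castSucc_lt_succ.le
    Fin.castSucc_lt_succ.le, unit_mul_unit Fin.castSucc_lt_succ.le Fin.castSucc_lt_succ.le,
    if_neg h1', if_neg h2', sub_zero]

/-- The superdiagonal entries of a commutator with a strictly upper triangular matrix. -/
lemma lie_apply_succ {w : upperTriangular R (s + 1)} (hw : ∀ a, w.1 a a = 0)
    (x : upperTriangular R (s + 1)) (j : Fin s) :
    (⁅w, x⁆).1 j.castSucc j.succ = -(w.1 j.castSucc j.succ * simpleRoot j x) := by
  rw [lie_apply_of_vanish, simpleRoot]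
  · ring
  · intro c d hc hd hcd
    rcases lt_trichotomy c d with h | rfl | h
    · exfalso
      rw [Fin.le_def] at hc hd
      rw [Fin.lt_def] at h
      rw [Ne, Ne, Fin.ext_iff, Fin.ext_iff] at hcd
      simp only [Fin.val_castSucc, Fin.val_succ] at *
      omega
    · exact hw c
    · exact apply_eq_zero w h

/-- The entries of a product of strictly upper triangular matrices two steps above the diagonal. -/
lemma mul_apply_succ_succ {u v : upperTriangular R (s + 1)} (hu : ∀ a, u.1 a a = 0)
    (hv : ∀ a, v.1 a a = 0) {j k : Fin s} (hjk : (j : ℕ) + 1 = k) :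
    (u * v).1 j.castSucc k.succ = u.1 j.castSucc j.succ * v.1 k.castSucc k.succ := by
  have hjk' : k.castSucc = j.succ := Fin.ext (by simp [hjk])
  rw [MulMemClass.coe_mul, Matrix.mul_apply, Finset.sum_eq_single j.succ, hjk']
  · intro c _ hc
    rcases lt_or_gt_of_ne hc with h | h
    · rcases (Fin.le_castSucc_iff.2 h).eq_or_lt with rfl | h'
      · rw [hu, zero_mul]
      · rw [apply_eq_zero u h', zero_mul]
    · have h' : k.succ ≤ c := by
        rw [Fin.lt_def] at h
        rw [Fin.le_def]
        simp only [Fin.val_succ] at *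
        omega
      rcases h'.eq_or_lt with rfl | h'
      · rw [hv, mul_zero]
      · rw [apply_eq_zero v h', mul_zero]
  · simp

lemma lie_lie_apply_succ_succ {u v : upperTriangular R (s + 1)} (hu : ∀ a, u.1 a a = 0)
    (hv : ∀ a, v.1 a a = 0) (x : upperTriangular R (s + 1)) {j k : Fin s} (hjk : (j : ℕ) + 1 = k) :
    (⁅⁅u, v⁆, x⁆).1 j.castSucc k.succ =
      -((u.1 j.castSucc j.succ * v.1 k.castSucc k.succ -
        v.1 j.castSucc j.succ * u.1 k.castSucc k.succ) * (simpleRoot j x + simpleRoot k x)) := by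
  have hjk' : k.castSucc = j.succ := Fin.ext (by simp [hjk])
  have hsup : ∀ i : Fin s, (⁅u, v⁆).1 i.castSucc i.succ = 0 := by
    intro i
    rw [lie_apply_succ hu, simpleRoot, hv, hv, sub_zero, mul_zero, neg_zero]
  rw [lie_apply_of_vanish]
  · rw [Ring.lie_def, AddSubgroupClass.coe_sub, Matrix.sub_apply, mul_apply_succ_succ hu hv hjk,
      mul_apply_succ_succ hv hu hjk, simpleRoot, simpleRoot, hjk']
    ring
  · intro c d hc hd hcd
    rcases lt_trichotomy c d with h | rfl | h
    · rw [Fin.le_def] at hc hd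
      rw [Fin.lt_def] at h
      rw [Ne, Ne, Fin.ext_iff, Fin.ext_iff] at hcd
      simp only [Fin.val_castSucc, Fin.val_succ] at *
      have hcs : (c : ℕ) < s := by omega
      obtain rfl : d = (⟨c, hcs⟩ : Fin s).succ := Fin.ext (by simp; omega)
      exact hsup ⟨c, hcs⟩
    · exact lie_apply_diag _ _ _
    · exact apply_eq_zero _ h

/-! ### Action of a Lie triple isomorphism on the simple roots -/

lemma map_apply_eq_sum (l : upperTriangular R n →ₗ[R] upperTriangular R n)
    (x : upperTriangular R n) (i j : Fin n) :
    (l x).1 i j = ∑ a, ∑ b, x.1 a b * (l (unit R a b)).1 i j := by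
  conv_lhs => rw [eq_sum_unit x]
  simp [map_sum, AddSubmonoidClass.coe_finsetSum, Matrix.sum_apply]

lemma unit_eq_lie_lie {a b : Fin n} (h : a < b) :
    unit R a b = ⁅⁅unit R a b, unit R b b⁆, unit R b b⁆ := by
  have : ⁅unit R a b, unit R b b⁆ = unit R a b := by
    simp [Ring.lie_def, unit_mul_unit, h.le, h.ne']
  rw [this, this]

/-- A Lie triple isomorphism preserves the strictly upper triangular matrices. -/
lemma map_apply_diag {l : upperTriangular R n ≃ₗ[R] upperTriangular R n} (hl : IsLieTripleIso l)
    {x : upperTriangular R n} (hx : ∀ a, x.1 a a = 0) (i : Fin n) : (l x).1 i i = 0 := by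
  rw [← LinearEquiv.coe_coe, map_apply_eq_sum]
  refine Finset.sum_eq_zero fun a _ => Finset.sum_eq_zero fun b _ => ?_
  rcases lt_trichotomy a b with h | rfl | h
  · rw [unit_eq_lie_lie h, LinearEquiv.coe_coe, hl, lie_apply_diag, mul_zero]
  · rw [hx, zero_mul]
  · rw [apply_eq_zero x h, zero_mul]

/-- A Lie triple isomorphism preserves the matrices that vanish on the first two diagonals. -/
lemma map_apply_succ {l : upperTriangular R (s + 1) ≃ₗ[R] upperTriangular R (s + 1)}
    (hl : IsLieTripleIso l) {x : upperTriangular R (s + 1)} (hx : ∀ a, x.1 a a = 0)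
    (hx' : ∀ i : Fin s, x.1 i.castSucc i.succ = 0) (j : Fin s) :
    (l x).1 j.castSucc j.succ = 0 := by
  rw [← LinearEquiv.coe_coe, map_apply_eq_sum]
  refine Finset.sum_eq_zero fun a _ => Finset.sum_eq_zero fun b _ => ?_
  rcases lt_trichotomy a b with h | rfl | h
  · have has : (a : ℕ) < s := by
      have := Fin.lt_def.1 h
      omega
    obtain ⟨i, rfl⟩ : ∃ i : Fin s, a = i.castSucc := ⟨⟨a, has⟩, rfl⟩
    have h1 : i.succ ≤ b := Fin.castSucc_lt_iff_succ_le.1 h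
    rcases h1.eq_or_lt with rfl | h2
    · rw [hx', zero_mul]
    -- Two or more steps above the diagonal, a unit is a triple bracket whose inner bracket has
    -- strictly upper triangular arguments; the image of such a bracket has zero superdiagonal.
    · have hu : unit R i.castSucc b =
          ⁅⁅unit R i.castSucc i.succ, unit R i.succ b⁆, unit R b b⁆ := by
        simp [Ring.lie_def, unit_mul_unit, Fin.castSucc_lt_succ.le, h1, h.le, h.ne']
      have hd : ∀ c d : Fin (s + 1), c < d → ∀ e, (l (unit R c d)).1 e e = 0 := fun c d hcd =>
        map_apply_diag hl fun e => by
          rw [unit_apply, if_neg]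
          rintro ⟨-, rfl, rfl⟩
          exact lt_irrefl _ hcd
      rw [hu, LinearEquiv.coe_coe, hl, lie_apply_succ (lie_apply_diag _ _),
        lie_apply_succ (hd _ _ Fin.castSucc_lt_succ), simpleRoot, hd _ _ h2, hd _ _ h2]
      simp
  · rw [hx, zero_mul]
  · rw [apply_eq_zero x h, zero_mul]

lemma map_apply_succ_eq_sum {l : upperTriangular R (s + 1) ≃ₗ[R] upperTriangular R (s + 1)}
    (hl : IsLieTripleIso l) {x : upperTriangular R (s + 1)} (hx : ∀ a, x.1 a a = 0) (j : Fin s) :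
    (l x).1 j.castSucc j.succ =
      ∑ i : Fin s, x.1 i.castSucc i.succ * (l (simpleUnit R i)).1 j.castSucc j.succ := by
  have hsum : ∀ (f : Fin s → upperTriangular R (s + 1)) (a b : Fin (s + 1)),
      (∑ i, f i).1 a b = ∑ i, (f i).1 a b := by
    intro f a b
    simp [AddSubmonoidClass.coe_finsetSum, Matrix.sum_apply]
  have hs : ∀ (r : R) (y : upperTriangular R (s + 1)) (a b : Fin (s + 1)),
      (r • y).1 a b = r * y.1 a b := fun _ _ _ _ => rfl
  have h := map_apply_succ hl (x := x - ∑ i : Fin s, x.1 i.castSucc i.succ • simpleUnit R i)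
    (fun a => by
      simp only [AddSubgroupClass.coe_sub, Matrix.sub_apply, hsum, hs, simpleUnit_apply_diag, hx]
      simp)
    (fun i => by
      simp only [AddSubgroupClass.coe_sub, Matrix.sub_apply, hsum, hs, simpleUnit_apply]
      simp) j
  rw [map_sub, AddSubgroupClass.coe_sub, Matrix.sub_apply, sub_eq_zero, map_sum, hsum] at h
  simpa only [map_smul, hs] using h

lemma isLieTripleIso_symm {l : upperTriangular R n ≃ₗ[R] upperTriangular R n}
    (hl : IsLieTripleIso l) : IsLieTripleIso l.symm := by
  intro a b c
  apply l.injective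
  rw [hl]
  simp only [LinearEquiv.apply_symm_apply]

/-- A Lie triple isomorphism intertwines the actions on the simple root spaces. -/
lemma simpleRoot_mul_simpleRoot {l : upperTriangular R (s + 1) ≃ₗ[R] upperTriangular R (s + 1)}
    (hl : IsLieTripleIso l) (i j : Fin s) (x y : upperTriangular R (s + 1)) :
    (l (simpleUnit R i)).1 j.castSucc j.succ * (simpleRoot j (l x) * simpleRoot j (l y)) =
      (simpleRoot i x * simpleRoot i y) * (l (simpleUnit R i)).1 j.castSucc j.succ := by
  have hd := map_apply_diag hl (simpleUnit_apply_diag i)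
  have h1 := map_apply_succ_eq_sum hl (x := ⁅⁅simpleUnit R i, x⁆, y⁆) (lie_apply_diag _ _) j
  rw [hl, lie_apply_succ (lie_apply_diag _ _), lie_apply_succ hd, Finset.sum_eq_single i] at h1
  · rw [lie_apply_succ (lie_apply_diag _ _), lie_apply_succ (simpleUnit_apply_diag i),
      simpleUnit_apply, if_pos rfl] at h1
    linear_combination h1
  · intro k _ hk
    rw [lie_apply_succ (lie_apply_diag _ _), lie_apply_succ (simpleUnit_apply_diag i),
      simpleUnit_apply, if_neg (Ne.symm hk)]
    simp
  · simp

/-- Surjectivity gives a nonzero superdiagonal coefficient, and cancelling it leaves `α_j(l x) α_j(l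
y) = α_i(x) α_i(y)`. At the coweight dual to `α_i` this yields `ε² = 1`. -/
lemma exists_simpleRoot_map [IsDomain R]
    {l : upperTriangular R (s + 1) ≃ₗ[R] upperTriangular R (s + 1)}
    (hl : IsLieTripleIso l) (j : Fin s) :
    ∃ (i : Fin s) (ε : R), (ε = 1 ∨ ε = -1) ∧ (l (simpleUnit R i)).1 j.castSucc j.succ ≠ 0 ∧
      ∀ x, simpleRoot j (l x) = ε * simpleRoot i x := by
  have hex : ∃ i : Fin s, (l (simpleUnit R i)).1 j.castSucc j.succ ≠ 0 := by
    by_contra! h0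
    have h1 := map_apply_succ_eq_sum hl (x := l.symm (simpleUnit R j))
      (map_apply_diag (isLieTripleIso_symm hl) (simpleUnit_apply_diag j)) j
    rw [LinearEquiv.apply_symm_apply, simpleUnit_apply] at h1
    simp [h0] at h1
  obtain ⟨i, hi⟩ := hex
  have key : ∀ x y, simpleRoot j (l x) * simpleRoot j (l y) = simpleRoot i x * simpleRoot i y := by
    intro x y
    apply mul_left_cancel₀ hi
    rw [simpleRoot_mul_simpleRoot hl]
    ring
  have h1 : simpleRoot i (coweight R i) = 1 := by rw [simpleRoot_coweight, if_pos rfl]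
  have hε := key (coweight R i) (coweight R i)
  rw [h1, mul_one] at hε
  refine ⟨i, simpleRoot j (l (coweight R i)), mul_self_eq_one_iff.1 hε, hi, fun x => ?_⟩
  have h2 := key (coweight R i) x
  rw [h1, one_mul] at h2
  linear_combination (-simpleRoot j (l x)) * hε + simpleRoot j (l (coweight R i)) * h2

/-- An injective walk with steps `±1` cannot turn back, and `s` steps-in-line positions fill all of
`Fin s`. -/
lemma eq_id_or_rev_of_step (τ : Fin s → Fin s) (hinj : Function.Injective τ)
    (hstep : ∀ j k : Fin s, (j : ℕ) + 1 = k → (τ j : ℕ) + 1 = τ k ∨ (τ k : ℕ) + 1 = τ j) :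
    (∀ j, τ j = j) ∨ ∀ j, τ j = j.rev := by
  rcases Nat.lt_or_ge s 2 with hs | hs
  · left
    intro j
    apply Fin.ext
    have := j.2
    have := (τ j).2
    omega
  rcases hstep ⟨0, by omega⟩ ⟨1, by omega⟩ rfl with h0 | h0
  · left
    have h1 : ∀ k (hk : k + 1 < s), (τ ⟨k, by omega⟩ : ℕ) + 1 = τ ⟨k + 1, hk⟩ := by
      intro k
      induction k with
      | zero => intro _; exact h0
      | succ k ih =>
        intro hk
        rcases hstep ⟨k + 1, by omega⟩ ⟨k + 1 + 1, hk⟩ rfl with h | h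
        · exact h
        · have h2 := ih (by omega)
          have h3 : τ ⟨k, by omega⟩ = τ ⟨k + 1 + 1, hk⟩ := Fin.ext (by omega)
          have := congrArg Fin.val (hinj h3)
          simp only at this
          omega
    have h2 : ∀ k (hk : k < s), (τ ⟨k, hk⟩ : ℕ) = τ ⟨0, by omega⟩ + k := by
      intro k
      induction k with
      | zero => intro _; rfl
      | succ k ih =>
        intro hk
        rw [← h1 k hk, ih (by omega)]
        rfl
    intro j
    apply Fin.ext
    have h3 := h2 (s - 1) (by omega)
    have h4 := h2 j j.2
    have h5 := (τ ⟨s - 1, by omega⟩).2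
    change (τ j : ℕ) = _ at h4
    omega
  · right
    have h1 : ∀ k (hk : k + 1 < s), (τ ⟨k + 1, hk⟩ : ℕ) + 1 = τ ⟨k, by omega⟩ := by
      intro k
      induction k with
      | zero => intro _; exact h0
      | succ k ih =>
        intro hk
        rcases hstep ⟨k + 1, by omega⟩ ⟨k + 1 + 1, hk⟩ rfl with h | h
        · have h2 := ih (by omega)
          have h3 : τ ⟨k, by omega⟩ = τ ⟨k + 1 + 1, hk⟩ := Fin.ext (by omega)
          have := congrArg Fin.val (hinj h3)
          simp only at this
          omega
        · exact h
    have h2 : ∀ k (hk : k < s), (τ ⟨k, hk⟩ : ℕ) + k = τ ⟨0, by omega⟩ := by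
      intro k
      induction k with
      | zero => intro _; rfl
      | succ k ih =>
        intro hk
        rw [← ih (by omega), ← h1 k hk]
        omega
    intro j
    apply Fin.ext
    have h3 := h2 (s - 1) (by omega)
    have h4 := h2 j j.2
    have h5 := (τ ⟨0, by omega⟩).2
    change (τ j : ℕ) + _ = _ at h4
    rw [Fin.val_rev]
    omega

/-- A Lie triple isomorphism acts on the simple roots, up to a common sign, by the identity or by
the reversal. -/
theorem simpleRoot_map_eq [IsDomain R]
    {l : upperTriangular R (s + 1) ≃ₗ[R] upperTriangular R (s + 1)} (hl : IsLieTripleIso l) :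
    ∃ ε : R, (ε = 1 ∨ ε = -1) ∧ ((∀ j x, simpleRoot j (l x) = ε * simpleRoot j x) ∨
      ∀ j x, simpleRoot j (l x) = ε * simpleRoot j.rev x) := by
  choose τ ε hε hG hτ using fun j => exists_simpleRoot_map hl j
  have hε0 : ∀ j, ε j ≠ 0 := by
    intro j
    rcases hε j with h | h <;> simp [h]
  have hinj : Function.Injective τ := by
    intro j k hjk
    by_contra hne
    have h1 := hτ j (l.symm (coweight R j))
    have h2 := hτ k (l.symm (coweight R j))
    rw [LinearEquiv.apply_symm_apply, simpleRoot_coweight, if_pos rfl] at h1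
    rw [LinearEquiv.apply_symm_apply, simpleRoot_coweight, if_neg hne, ← hjk] at h2
    have h3 := (mul_eq_zero.1 h2.symm).resolve_left (hε0 k)
    rw [h3, mul_zero] at h1
    exact one_ne_zero h1
  have huniq : ∀ j k, k ≠ τ j → (l (simpleUnit R k)).1 j.castSucc j.succ = 0 := by
    intro j k hk
    have h1 := simpleRoot_mul_simpleRoot hl k j (coweight R k) (coweight R k)
    rw [hτ, simpleRoot_coweight, if_neg hk, simpleRoot_coweight, if_pos rfl] at h1
    simpa using h1.symm
  -- Apply `l` to the vanishing triple bracket and read the entry two steps above the diagonal; by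
  -- `huniq` only one product of coefficients survives, and it is nonzero.
  have hpair : ∀ j k : Fin s, (j : ℕ) + 1 = k →
      ∀ h, ⁅⁅simpleUnit R (τ j), simpleUnit R (τ k)⁆, h⁆ = 0 →
        ε j * simpleRoot (τ j) h + ε k * simpleRoot (τ k) h = 0 := by
    intro j k hjk h hh
    have hne : τ k ≠ τ j := fun e => by
      have := hinj e
      subst this
      omega
    have h1 := lie_lie_apply_succ_succ (map_apply_diag hl (simpleUnit_apply_diag (τ j)))
      (map_apply_diag hl (simpleUnit_apply_diag (τ k))) (l h) hjk
    rw [← hl, hh, map_zero, huniq j (τ k) hne, zero_mul, sub_zero, hτ, hτ] at h1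
    have h2 := neg_eq_zero.1 h1.symm
    exact (mul_eq_zero.1 h2).resolve_left (mul_ne_zero (hG j) (hG k))
  have hstep : ∀ j k : Fin s, (j : ℕ) + 1 = k →
      (τ j : ℕ) + 1 = τ k ∨ (τ k : ℕ) + 1 = τ j := by
    intro j k hjk
    by_contra! hcon
    have hne : τ j ≠ τ k := fun e => by
      have := hinj e
      subst this
      omega
    have h1 := hpair j k hjk (coweight R (τ j)) (by
      rw [lie_simpleUnit_eq_zero hcon.1 hcon.2, ring_zero_lie])
    rw [simpleRoot_coweight, simpleRoot_coweight, if_pos rfl, if_neg hne] at h1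
    exact hε0 j (by linear_combination h1)
  have hεstep : ∀ j k : Fin s, (j : ℕ) + 1 = k → ε k = ε j := by
    intro j k hjk
    have hne : τ j ≠ τ k := fun e => by
      have := hinj e
      subst this
      omega
    have h1 := hpair j k hjk _ (lie_lie_simpleUnit_coweight (τ j) (τ k))
    rw [simpleRoot_sub, simpleRoot_sub, simpleRoot_coweight, simpleRoot_coweight,
      simpleRoot_coweight, simpleRoot_coweight, if_pos rfl, if_pos rfl, if_neg hne,
      if_neg hne.symm] at h1
    linear_combination -h1
  obtain ⟨ε₀, hε₀, hconst⟩ : ∃ ε₀ : R, (ε₀ = 1 ∨ ε₀ = -1) ∧ ∀ j, ε j = ε₀ := by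
    rcases Nat.eq_zero_or_pos s with rfl | hs
    · exact ⟨1, Or.inl rfl, fun j => j.elim0⟩
    · refine ⟨ε ⟨0, hs⟩, hε _, ?_⟩
      have : ∀ k (hk : k < s), ε ⟨k, hk⟩ = ε ⟨0, hs⟩ := by
        intro k
        induction k with
        | zero => intro _; rfl
        | succ k ih =>
          intro hk
          rw [← ih (by omega)]
          exact hεstep _ _ rfl
      exact fun j => this j j.2
  refine ⟨ε₀, hε₀, (eq_id_or_rev_of_step τ hinj hstep).imp ?_ ?_⟩ <;>
  · intro h j x
    rw [hτ, hconst, h]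

/-! ### The antitranspose and removal of sign and reversal -/

/-- The reflection of a matrix in its antidiagonal. -/
def antitranspose (R : Type*) [CommRing R] (n : ℕ) :
    upperTriangular R n ≃ₗ[R] upperTriangular R n where
  toFun x := ⟨fun a b => x.1 b.rev a.rev, fun _ _ h => apply_eq_zero x (Fin.rev_lt_rev.2 h)⟩
  invFun x := ⟨fun a b => x.1 b.rev a.rev, fun _ _ h => apply_eq_zero x (Fin.rev_lt_rev.2 h)⟩
  map_add' _ _ := rfl
  map_smul' _ _ := rfl
  left_inv x := Subtype.ext (by ext; simp)
  right_inv x := Subtype.ext (by ext; simp)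

lemma antitranspose_apply (x : upperTriangular R n) (a b : Fin n) :
    (antitranspose R n x).1 a b = x.1 b.rev a.rev := rfl

lemma antitranspose_antitranspose (x : upperTriangular R n) :
    antitranspose R n (antitranspose R n x) = x :=
  (antitranspose R n).left_inv x

lemma isAlgAntiIso_antitranspose : IsAlgAntiIso (antitranspose R n) := by
  intro x y
  apply Subtype.ext
  ext a b
  rw [antitranspose_apply, MulMemClass.coe_mul, MulMemClass.coe_mul, Matrix.mul_apply,
    Matrix.mul_apply, ← Equiv.sum_comp Fin.revPerm]
  simp [antitranspose_apply, mul_comm]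

lemma isLieTripleIso_antitranspose : IsLieTripleIso (antitranspose R n) := by
  intro x y z
  simp only [Ring.lie_def, map_sub, isAlgAntiIso_antitranspose _ _, mul_sub, sub_mul]
  abel

lemma simpleRoot_antitranspose (j : Fin s) (x : upperTriangular R (s + 1)) :
    simpleRoot j (antitranspose R (s + 1) x) = -simpleRoot j.rev x := by
  simp only [simpleRoot, antitranspose_apply, Fin.rev_castSucc, Fin.rev_succ]
  ring

theorem exists_algIso_of_simpleRoot_map [IsDomain R] (h2 : (2 : R) ≠ 0)
    (l : upperTriangular R (s + 1) ≃ₗ[R] upperTriangular R (s + 1)) (hl : IsLieTripleIso l)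
    {ε : R} (hε : ε = 1 ∨ ε = -1) (hr : ∀ j x, simpleRoot j (l x) = ε * simpleRoot j x) :
    ∃ (m : upperTriangular R (s + 1) ≃ₗ[R] upperTriangular R (s + 1))
      (ν : upperTriangular R (s + 1) →ₗ[R] upperTriangular R (s + 1)),
      IsAlgIso m ∧ (∀ x, ν x ∈ Submodule.span R {(1 : upperTriangular R (s + 1))}) ∧
      (∀ x y z : upperTriangular R (s + 1), ν ⁅⁅x, y⁆, z⁆ = 0) ∧
      ((∀ x, l x = m x + ν x) ∨ ∀ x, l x = -m x + ν x) := by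
  have diag : ∀ l' : upperTriangular R (s + 1) ≃ₗ[R] upperTriangular R (s + 1),
      (∀ j x, simpleRoot j (l' x) = simpleRoot j x) →
      ∀ x a, (l' x).1 a a - (l' x).1 0 0 = x.1 a a - x.1 0 0 := by
    intro l' hl' x a
    induction a using Fin.induction with
    | zero => simp
    | succ j ih =>
      have h := hl' j x
      rw [simpleRoot, simpleRoot] at h
      linear_combination ih - h
  rcases hε with rfl | rfl
  · obtain ⟨m, ν, hm, h1, h3, h4⟩ := exists_algIso_add_central h2 l hl
      (diag l fun j x => by rw [hr, one_mul])
    exact ⟨m, ν, hm, h1, h3, Or.inl h4⟩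
  -- A triple bracket is odd in its arguments jointly, so `-l` is again a Lie triple isomorphism.
  · let l' := l.trans (LinearEquiv.neg R)
    have hl' : ∀ x, l' x = -l x := fun _ => rfl
    have hroot : ∀ j x, simpleRoot j (l' x) = simpleRoot j x := by
      intro j x
      have h := hr j x
      rw [hl', ← zero_sub, simpleRoot_sub, h]
      simp [simpleRoot]
    obtain ⟨m, ν, hm, h1, h3, h4⟩ := exists_algIso_add_central h2 l' (by
      intro x y z
      rw [hl', hl', hl', hl', hl, ring_neg_lie, ring_lie_neg, ring_neg_lie, neg_neg,
        ring_lie_neg, ring_neg_lie]) (diag l' hroot)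
    refine ⟨m, -ν, hm, fun x => ?_, fun x y z => ?_, Or.inr fun x => ?_⟩
    · exact Submodule.neg_mem _ (h1 x)
    · rw [LinearMap.neg_apply, h3, neg_zero]
    · have h := h4 x
      rw [hl'] at h
      rw [LinearMap.neg_apply, ← neg_add, ← h, neg_neg]

end UpperTriangular

theorem corollary4p5 {R : Type*} [CommRing R] [IsDomain R] (h2 : IsUnit (2 : R))
    (n : ℕ) (hn : 2 ≤ n)
    (l : upperTriangular R n ≃ₗ[R] upperTriangular R n) (hl : IsLieTripleIso l) :
    ∃ (m : upperTriangular R n ≃ₗ[R] upperTriangular R n)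
      (ν : upperTriangular R n →ₗ[R] upperTriangular R n),
      (IsAlgIso m ∨ IsAlgAntiIso m) ∧
      (∀ x, ν x ∈ Submodule.span R {(1 : upperTriangular R n)}) ∧
      (∀ x y z : upperTriangular R n, ν ⁅⁅x, y⁆, z⁆ = 0) ∧
      ((∀ x, l x = m x + ν x) ∨ (∀ x, l x = -m x + ν x)) := by
  open UpperTriangular in
  obtain ⟨s, rfl⟩ : ∃ s, n = s + 1 := ⟨n - 1, by omega⟩
  obtain ⟨ε, hε, h | h⟩ := simpleRoot_map_eq hl
  · obtain ⟨m, ν, hm, h1⟩ := exists_algIso_of_simpleRoot_map h2.ne_zero l hl hε h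
    exact ⟨m, ν, Or.inl hm, h1⟩
  -- The antitranspose sends `α_j` to the negative of its reverse: composing with it undoes the
  -- reversal and turns `ε` into `-ε`.
  · obtain ⟨m, ν, hm, h1, h3, h4⟩ := exists_algIso_of_simpleRoot_map (ε := -ε) h2.ne_zero
      ((antitranspose R (s + 1)).trans l)
      (fun x y z => by
        simp only [LinearEquiv.trans_apply, isLieTripleIso_antitranspose _ _ _, hl _ _ _])
      (by rcases hε with rfl | rfl <;> simp)
      (fun j x => by
        rw [LinearEquiv.trans_apply, h, simpleRoot_antitranspose, Fin.rev_rev]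
        ring)
    refine ⟨(antitranspose R (s + 1)).trans m, ν ∘ₗ (antitranspose R (s + 1)).toLinearMap,
      Or.inr fun x y => ?_, fun x => h1 _, fun x y z => ?_, h4.imp (fun h4 x => ?_) fun h4 x => ?_⟩
    · rw [LinearEquiv.trans_apply, isAlgAntiIso_antitranspose, hm]
      rfl
    · rw [LinearMap.comp_apply, LinearEquiv.coe_coe, isLieTripleIso_antitranspose, h3]
    all_goals
      have h5 := h4 (antitranspose R (s + 1) x)
      rwa [LinearEquiv.trans_apply, antitranspose_antitranspose] at h5
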